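/- Let $G$ be a finite simple graph. For an edge $xy$ of $G$ let $\theta(xy) = d(x) + d(y)$, where $d(v)$ is the degree of the vertex $v$ in $G$, and let the Ore-degree of $G$ be $\theta(G) = \max_{xy \in E(G)} \theta(xy)$ (with $\theta(G) = 0$ if $G$ has no edges). Let $\chi(G)$ be the chromatic number of $G$. If $6 \leq \chi(G) = \left\lfloor \frac{\theta(G)}{2} \right\rfloor + 1$, then $G$ contains the complete graph $K_{\chi(G)}$ as a subgraph. -/

import Mathlib

namespace SimpleGraph

/-- The Ore-degree `θ(xy) = d(x) + d(y)` of an edge `xy` of a finite graph. -/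
def edgeOreDegree {V : Type*} [Fintype V] (G : SimpleGraph V) [DecidableRel G.Adj] :
    Sym2 V → ℕ :=
  Sym2.lift ⟨fun x y => G.degree x + G.degree y, fun _ _ => Nat.add_comm _ _⟩

/-- The Ore-degree `θ(G)` of a finite graph: the maximum of the Ore-degrees of its edges
(and `0` if there are no edges). -/
def oreDegree {V : Type*} [Fintype V] [DecidableEq V] (G : SimpleGraph V)
    [DecidableRel G.Adj] : ℕ :=
  G.edgeFinset.sup G.edgeOreDegree

end SimpleGraph

/-!
Write `n = ⌊θ(G) / 2⌋` and pass to an `(n + 1)`-vertex-critical subgraph. All its degrees are `n` or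
`n + 1`, no two vertices of degree `n + 1` are adjacent, and it suffices to find a vertex of degree
`n` whose closed neighbourhood is a clique.

Such a vertex comes from a Lovász–Mozhan partition. Split the `n` colours as `2 + (n - 2)` and
choose a partition of the vertices into two sides that minimises, first, the number of edges inside
the two sides, suitably weighted, and then the number of obstructions, that is, of subgraphs
critical for the number of colours given to their side. Every obstruction is then a component of its
side and contains an edge joining two vertices of degree `n`; when one of these changes sides, the
new partition is again optimal, so the vertex becomes part of a new obstruction. Iterating, the
moving vertex must eventually complete what an earlier obstruction left behind. Counting neighbours
at the first such return produces a vertex `p` of degree `n`, with at least two neighbours of degree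
`n`, each of them adjacent to all other neighbours of `p`.

Finally, let `h` be the number of neighbours of `p` of degree `n + 1`. Colour the graph outside
`N[p]` with `n` colours. Each of these `h` neighbours has at most `h` neighbours there, hence at
least `n - h` free colours, and `h (n - h) > n` if `h ≥ 2`, because `n ≥ 5` and `h ≤ n - 2`; so two
of them could be given the same colour. Such a colouring extends greedily to the whole graph, the
vertex `p` coming last, which is impossible. So `h ≤ 1`, and `N[p]` is a clique.
-/

namespace OreBrooks

open Finset

section DegreeIn

variable {V : Type*} (G : SimpleGraph V) [DecidableRel G.Adj] {S T : Finset V}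

/-- The number of neighbours of `v` in `S`; the vertex `v` itself need not lie in `S`. -/
def degreeIn (S : Finset V) (v : V) : ℕ := #{w ∈ S | G.Adj v w}

variable {G}

theorem degreeIn_mono (h : S ⊆ T) (v : V) : degreeIn G S v ≤ degreeIn G T v :=
  card_le_card (filter_subset_filter _ h)

theorem degreeIn_univ [Fintype V] (v : V) : degreeIn G univ v = G.degree v := by
  rw [degreeIn, ← G.neighborFinset_eq_filter, G.card_neighborFinset_eq_degree]

variable [DecidableEq V]

theorem degreeIn_union (h : Disjoint S T) (v : V) :
    degreeIn G (S ∪ T) v = degreeIn G S v + degreeIn G T v := by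
  rw [degreeIn, filter_union, card_union_of_disjoint (disjoint_filter_filter h)]
  rfl

theorem degreeIn_insert {x : V} (hx : x ∉ S) (v : V) :
    degreeIn G (insert x S) v = degreeIn G S v + if G.Adj v x then 1 else 0 := by
  rw [degreeIn, filter_insert]
  split_ifs
  · exact card_insert_of_notMem fun h => hx (mem_of_mem_filter x h)
  · rfl

theorem degreeIn_erase_add_one {v x : V} (hx : x ∈ S) (hvx : G.Adj v x) :
    degreeIn G (S.erase x) v + 1 = degreeIn G S v := by
  conv_rhs => rw [← insert_erase hx, degreeIn_insert (notMem_erase x S), if_pos hvx]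

theorem degreeIn_univ_erase_add_one [Fintype V] {v x : V} (hvx : G.Adj v x) :
    degreeIn G (univ.erase x) v + 1 = G.degree v := by
  rw [degreeIn_erase_add_one (mem_univ x) hvx, degreeIn_univ]

theorem degreeIn_erase_self (S : Finset V) (v : V) : degreeIn G (S.erase v) v = degreeIn G S v := by
  rw [degreeIn, filter_erase, erase_eq_of_notMem (by simp), degreeIn]

theorem adj_iff_adj_of_degreeIn_insert_eq {v x y : V} (hx : x ∉ S) (hy : y ∉ S)
    (h : degreeIn G (insert x S) v = degreeIn G (insert y S) v) : G.Adj v x ↔ G.Adj v y := by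
  rw [degreeIn_insert hx, degreeIn_insert hy] at h
  split_ifs at h <;> simp_all

end DegreeIn

section Component

variable {V : Type*} (G : SimpleGraph V)

/-- `T` is a union of connected components of the induced subgraph `G[U]`. -/
structure IsClosedIn (U T : Finset V) : Prop where
  subset : T ⊆ U
  mem_of_adj : ∀ ⦃x⦄, x ∈ T → ∀ ⦃y⦄, y ∈ U → G.Adj x y → y ∈ T

/-- The induced subgraph `G[D]` is connected, or `D` is empty: no proper nonempty part of `D` is
cut off from the rest. -/
def ConnectedOn (D : Finset V) : Prop :=
  ∀ ⦃T⦄, T.Nonempty → IsClosedIn G D T → T = D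

/-- `D` is a connected component of the induced subgraph `G[U]`, or empty. -/
structure IsComponentIn (U D : Finset V) : Prop extends IsClosedIn G U D where
  connectedOn : ConnectedOn G D

variable {G} {U D E : Finset V}

theorem IsClosedIn.inter [DecidableEq V] (hD : IsClosedIn G U D) (hE : IsClosedIn G U E) :
    IsClosedIn G D (D ∩ E) where
  subset := inter_subset_left
  mem_of_adj _ hx _ hy hxy :=
    mem_inter.2 ⟨hy, hE.mem_of_adj (mem_inter.1 hx).2 (hD.subset hy) hxy⟩

theorem IsClosedIn.erase [DecidableEq V] (hD : IsClosedIn G U D) (x : V) :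
    IsClosedIn G (U.erase x) (D.erase x) where
  subset := erase_subset_erase x hD.subset
  mem_of_adj _ ha _ hb hab :=
    mem_erase.2 ⟨ne_of_mem_erase hb, hD.mem_of_adj (mem_of_mem_erase ha) (mem_of_mem_erase hb) hab⟩

theorem IsComponentIn.eq_of_mem_of_mem (hD : IsComponentIn G U D) (hE : IsComponentIn G U E)
    {z : V} (hzD : z ∈ D) (hzE : z ∈ E) : D = E := by
  classical
  have hne : (D ∩ E).Nonempty := ⟨z, mem_inter.2 ⟨hzD, hzE⟩⟩
  calc D = D ∩ E := (hD.connectedOn hne (hD.inter hE.toIsClosedIn)).symm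
    _ = E := hE.connectedOn hne (inter_comm D E ▸ hE.inter hD.toIsClosedIn)

end Component

section ProperOn

variable {V α β : Type*} (G : SimpleGraph V) {S T : Finset V}

/-- `c` is a proper colouring of the induced subgraph `G[S]`; its values outside `S` are
irrelevant. -/
def IsProperOn (S : Finset V) (c : V → α) : Prop :=
  ∀ ⦃x⦄, x ∈ S → ∀ ⦃y⦄, y ∈ S → G.Adj x y → c x ≠ c y

variable {G} {c : V → α}

theorem IsProperOn.mono (hc : IsProperOn G T c) (h : S ⊆ T) : IsProperOn G S c :=
  fun _ hx _ hy => hc (h hx) (h hy)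

theorem IsProperOn.comp_injective (hc : IsProperOn G S c) {f : α → β}
    (hf : Function.Injective f) : IsProperOn G S (f ∘ c) :=
  fun _ hx _ hy hxy => hf.ne (hc hx hy hxy)

variable [DecidableEq V]

theorem IsProperOn.piecewise {c' : V → α} (hc : IsProperOn G S c) (hc' : IsProperOn G T c')
    (h : ∀ x ∈ S, ∀ y ∈ T, y ∉ S → G.Adj x y → c x ≠ c' y) :
    IsProperOn G (S ∪ T) (S.piecewise c c') := by
  intro x hx y hy hxy
  have hT : ∀ z ∈ S ∪ T, z ∉ S → z ∈ T := fun z hz hzS => (mem_union.1 hz).resolve_left hzS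
  by_cases hxS : x ∈ S <;> by_cases hyS : y ∈ S <;> simp only [Finset.piecewise, hxS, hyS, if_true,
    if_false]
  · exact hc hxS hyS hxy
  · exact h x hxS y (hT y hy hyS) hyS hxy
  · exact (h y hyS x (hT x hx hxS) hxS hxy.symm).symm
  · exact hc' (hT x hx hxS) (hT y hy hyS) hxy

theorem IsProperOn.piecewise_const {I : Finset V} (hc : IsProperOn G S c) (hI : G.IsIndepSet I)
    {γ : α} (hγ : ∀ x ∈ I, ∀ y ∈ S, G.Adj x y → c y ≠ γ) :
    IsProperOn G (I ∪ S) (I.piecewise (fun _ => γ) c) :=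
  IsProperOn.piecewise (fun _ hx _ hy hxy => (hI hx hy hxy.ne hxy).elim) hc
    fun x hx y hy _ hxy => (hγ x hx y hy hxy).symm

variable [DecidableRel G.Adj] [Fintype α]

theorem IsProperOn.exists_insert [DecidableEq α] (hc : IsProperOn G S c) {v : V} (hv : v ∉ S)
    (hlt : #({w ∈ S | G.Adj v w}.image c) < Fintype.card α) :
    ∃ c' : V → α, IsProperOn G (insert v S) c' ∧ ∀ x ∈ S, c' x = c x := by
  obtain ⟨γ, hγ⟩ : ∃ γ, γ ∉ {w ∈ S | G.Adj v w}.image c := by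
    by_contra! h
    exact hlt.not_ge (card_le_card fun γ _ => h γ)
  refine ⟨({v} : Finset V).piecewise (fun _ => γ) c,
    insert_eq v S ▸ hc.piecewise_const (by simp) ?_,
    fun x hx => piecewise_eq_of_notMem _ _ _ ?_⟩
  · rintro x hx y hy hxy rfl
    rw [mem_singleton] at hx
    exact hγ (mem_image_of_mem c (mem_filter.2 ⟨hy, hx ▸ hxy⟩))
  · exact notMem_singleton.2 (ne_of_mem_of_not_mem hx hv)

theorem IsProperOn.exists_insert_of_not_injOn (hc : IsProperOn G S c) {v : V} (hv : v ∉ S)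
    (hle : degreeIn G S v ≤ Fintype.card α) (hinj : ¬ Set.InjOn c {w ∈ S | G.Adj v w}) :
    ∃ c' : V → α, IsProperOn G (insert v S) c' ∧ ∀ x ∈ S, c' x = c x := by
  classical
  have hlt : #({w ∈ S | G.Adj v w}.image c) < #{w ∈ S | G.Adj v w} :=
    card_image_le.lt_of_ne fun h => hinj (by simpa using card_image_iff.1 h)
  exact hc.exists_insert hv (hlt.trans_le hle)

theorem IsProperOn.exists_insert_of_degreeIn_lt (hc : IsProperOn G S c) {v : V} (hv : v ∉ S)
    (hlt : degreeIn G S v < Fintype.card α) :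
    ∃ c' : V → α, IsProperOn G (insert v S) c' ∧ ∀ x ∈ S, c' x = c x := by
  classical exact hc.exists_insert hv (card_image_le.trans_lt hlt)

theorem IsProperOn.exists_union_of_degreeIn_lt (hc : IsProperOn G S c) (T : Finset V)
    (hST : Disjoint S T) (hlt : ∀ v ∈ T, degreeIn G (S ∪ T) v < Fintype.card α) :
    ∃ c' : V → α, IsProperOn G (S ∪ T) c' ∧ ∀ x ∈ S, c' x = c x := by
  induction T using Finset.induction_on with
  | empty => exact ⟨c, by rwa [union_empty], fun _ _ => rfl⟩
  | insert v T hvT ih =>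
    rw [disjoint_insert_right] at hST
    have hlt' : ∀ w ∈ insert v T, degreeIn G (S ∪ T) w < Fintype.card α := fun w hw =>
      (degreeIn_mono (union_subset_union_right (subset_insert v T)) w).trans_lt (hlt w hw)
    obtain ⟨c₁, h₁, hext₁⟩ := ih hST.2 fun w hw => hlt' w (mem_insert_of_mem hw)
    obtain ⟨c₂, h₂, hext₂⟩ := h₁.exists_insert_of_degreeIn_lt
      (notMem_union.2 ⟨hST.1, hvT⟩) (hlt' v (mem_insert_self v T))
    rw [union_insert]
    exact ⟨c₂, h₂, fun x hx => (hext₂ x (mem_union_left T hx)).trans (hext₁ x hx)⟩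

end ProperOn

section Critical

variable {V : Type*} (G : SimpleGraph V) {S T : Finset V} {m m₁ m₂ : ℕ}

/-- The induced subgraph `G[S]` is `m`-colourable. -/
def ColorableOn (S : Finset V) (m : ℕ) : Prop :=
  ∃ c : V → Fin m, IsProperOn G S c

variable {G}

theorem colorableOn_univ_iff [Fintype V] : ColorableOn G univ m ↔ G.Colorable m := by
  constructor
  · rintro ⟨c, hc⟩
    exact ⟨SimpleGraph.Coloring.mk c fun {x y} h => hc (mem_univ x) (mem_univ y) h⟩
  · rintro ⟨c⟩
    exact ⟨c, fun _ _ _ _ h => c.valid h⟩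

theorem ColorableOn.mono (h : ColorableOn G T m) (hST : S ⊆ T) : ColorableOn G S m :=
  h.imp fun _ hc => hc.mono hST

theorem ColorableOn.mono_right (h : ColorableOn G S m₁) (hm : m₁ ≤ m₂) : ColorableOn G S m₂ :=
  let ⟨c, hc⟩ := h
  ⟨Fin.castLE hm ∘ c, hc.comp_injective (Fin.castLE_injective hm)⟩

variable [DecidableEq V]

theorem ColorableOn.union (hS : ColorableOn G S m₁) (hT : ColorableOn G T m₂) :
    ColorableOn G (S ∪ T) (m₁ + m₂) := by
  obtain ⟨c₁, h₁⟩ := hS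
  obtain ⟨c₂, h₂⟩ := hT
  refine ⟨_, (h₁.comp_injective (Fin.castAdd_injective m₁ m₂)).piecewise
    (h₂.comp_injective (Fin.natAdd_injective m₂ m₁)) fun x _ y _ _ _ => ?_⟩
  exact Fin.ne_of_lt ((Fin.castAdd_lt m₂ (c₁ x)).trans_le (Fin.le_coe_natAdd m₁ (c₂ y)))

variable (G) in
/-- The induced subgraph `G[S]` is vertex-critical of chromatic number greater than `m`: it is not
`m`-colourable, but becomes so when any vertex is deleted. -/
structure IsCritical (S : Finset V) (m : ℕ) : Prop where
  not_colorableOn : ¬ ColorableOn G S m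
  colorableOn_erase : ∀ v ∈ S, ColorableOn G (S.erase v) m

theorem exists_isCritical_of_not_colorableOn (h : ¬ ColorableOn G S m) :
    ∃ T ⊆ S, IsCritical G T m := by
  induction S using Finset.strongInduction with
  | H S ih =>
    by_cases hS : ∀ v ∈ S, ColorableOn G (S.erase v) m
    · exact ⟨S, Subset.rfl, h, hS⟩
    · push Not at hS
      obtain ⟨v, hv, hcol⟩ := hS
      obtain ⟨T, hT, hT'⟩ := ih _ (erase_ssubset hv) hcol
      exact ⟨T, hT.trans (erase_subset v S), hT'⟩

namespace IsCritical

theorem colorableOn_of_ssubset (h : IsCritical G S m) (hT : T ⊂ S) : ColorableOn G T m := by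
  obtain ⟨v, hv, hvT⟩ := exists_of_ssubset hT
  exact (h.colorableOn_erase v hv).mono (subset_erase.2 ⟨hT.subset, hvT⟩)

theorem le_degreeIn [DecidableRel G.Adj] (h : IsCritical G S m) {v : V} (hv : v ∈ S) :
    m ≤ degreeIn G S v := by
  by_contra! hlt
  obtain ⟨c, hc⟩ := h.colorableOn_erase v hv
  obtain ⟨c', hc', -⟩ := hc.exists_insert_of_degreeIn_lt (notMem_erase v S) <| by
    rw [Fintype.card_fin]
    exact (degreeIn_mono (erase_subset v S) v).trans_lt hlt
  exact h.not_colorableOn ⟨c', insert_erase hv ▸ hc'⟩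

theorem connectedOn (h : IsCritical G S m) : ConnectedOn G S := by
  intro T hT hTS
  by_contra hne
  obtain ⟨c₁, h₁⟩ := h.colorableOn_of_ssubset (hTS.subset.ssubset_of_ne hne)
  obtain ⟨c₂, h₂⟩ := h.colorableOn_of_ssubset (sdiff_ssubset hTS.subset hT)
  refine h.not_colorableOn ⟨T.piecewise c₁ c₂, union_sdiff_of_subset hTS.subset ▸
    h₁.piecewise h₂ fun x hx y hy hyT hxy => ?_⟩
  exact (hyT (hTS.mem_of_adj hx (mem_sdiff.1 hy).1 hxy)).elim

theorem connectedOn_erase (h : IsCritical G S m) {x : V} (hx : x ∈ S) :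
    ConnectedOn G (S.erase x) := by
  intro T hT hTx
  by_contra hne
  have hTS : T ⊆ S := hTx.subset.trans (erase_subset x S)
  have hxT : insert x T ⊂ S := by
    obtain ⟨y, hy, hyT⟩ := exists_of_ssubset (hTx.subset.ssubset_of_ne hne)
    refine (ssubset_iff_of_subset (insert_subset hx hTS)).2 ⟨y, mem_of_mem_erase hy, ?_⟩
    simp [hyT, ne_of_mem_erase hy]
  obtain ⟨c₁, h₁⟩ := h.colorableOn_of_ssubset hxT
  obtain ⟨c₂, h₂⟩ := h.colorableOn_of_ssubset (sdiff_ssubset hTS hT)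
  -- Permuting the colours of `c₁` makes the two colourings agree at the cut vertex `x`.
  let e := Equiv.swap (c₁ x) (c₂ x)
  have he : IsProperOn G (insert x T) (e ∘ c₁) := h₁.comp_injective e.injective
  refine h.not_colorableOn ⟨T.piecewise (e ∘ c₁) c₂, union_sdiff_of_subset hTS ▸
    (he.mono (subset_insert x T)).piecewise h₂ fun a ha b hb hbT hab => ?_⟩
  have hbx : b = x := by
    by_contra hbx
    exact hbT (hTx.mem_of_adj ha (mem_erase.2 ⟨hbx, (mem_sdiff.1 hb).1⟩) hab)
  subst hbx
  simpa [e] using he (mem_insert_of_mem ha) (mem_insert_self b T) hab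

theorem induce (h : IsCritical G S m) (hm : 0 < m) :
    IsCritical (G.induce (S : Set V)) univ m where
  not_colorableOn := fun ⟨c, hc⟩ => h.not_colorableOn
    ⟨fun v => if hv : v ∈ S then c ⟨v, hv⟩ else ⟨0, hm⟩, fun x hx y hy hxy => by
      simpa only [dif_pos hx, dif_pos hy] using @hc ⟨x, hx⟩ (mem_univ _) ⟨y, hy⟩ (mem_univ _) hxy⟩
  colorableOn_erase v _ := by
    obtain ⟨c, hc⟩ := h.colorableOn_erase v v.2
    have hv : ∀ x ∈ univ.erase v, (x : V) ∈ S.erase v := fun x hx =>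
      mem_erase.2 ⟨Subtype.coe_ne_coe.2 (ne_of_mem_erase hx), x.2⟩
    exact ⟨fun x => c x, fun x hx y hy hxy => hc (hv x hx) (hv y hy) hxy⟩

end IsCritical

end Critical

section Partition

variable {V : Type*}

/-- The partition `σ` with the vertex `x` moved to the other side. -/
def switch [DecidableEq V] (σ : V → Bool) (x : V) : V → Bool := Function.update σ x (!σ x)

section Switch

variable [DecidableEq V] (σ : V → Bool)

@[simp] theorem switch_self (x : V) : switch σ x x = !σ x := Function.update_self x _ σ

theorem switch_of_ne {x v : V} (h : v ≠ x) : switch σ x v = σ v := Function.update_of_ne h _ σ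

@[simp] theorem switch_switch (x : V) : switch (switch σ x) x = σ := by
  simp [switch]

end Switch

variable [Fintype V]

/-- The vertices on side `b` of a partition `σ` of the vertex set into two sides. -/
def side (σ : V → Bool) (b : Bool) : Finset V := {v | σ v = b}

@[simp] theorem mem_side {σ : V → Bool} {b : Bool} {v : V} : v ∈ side σ b ↔ σ v = b := by
  simp [side]

theorem disjoint_side_side_not (σ : V → Bool) (b : Bool) : Disjoint (side σ b) (side σ !b) :=
  disjoint_left.2 fun v h h' => by simp_all

theorem side_union_side_not [DecidableEq V] (σ : V → Bool) (b : Bool) :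
    side σ b ∪ side σ (!b) = univ := by
  ext v
  cases b <;> simp [or_comm]

theorem degreeIn_side_add_degreeIn_side_not {G : SimpleGraph V} [DecidableRel G.Adj]
    (σ : V → Bool) (b : Bool) (v : V) :
    degreeIn G (side σ b) v + degreeIn G (side σ !b) v = G.degree v := by
  classical rw [← degreeIn_union (disjoint_side_side_not σ b), side_union_side_not, degreeIn_univ]

variable [DecidableEq V]

theorem erase_side_not (σ : V → Bool) (x : V) : (side σ (!σ x)).erase x = side σ (!σ x) :=
  erase_eq_of_notMem (by simp)

theorem erase_side_switch (σ : V → Bool) (x : V) (b : Bool) :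
    (side (switch σ x) b).erase x = (side σ b).erase x := by
  ext v
  simp +contextual [switch_of_ne]

section Potential

variable (G : SimpleGraph V) [DecidableRel G.Adj]

/-- Twice the number of edges inside the two sides, where each vertex on side `b` is credited with
`r b`: the function minimised in Lovász's degree-splitting argument. -/
def potential (r : Bool → ℕ) (σ : V → Bool) : ℤ :=
  ∑ v, (degreeIn G (side σ (σ v)) v : ℤ) - 2 * ∑ v, (r (σ v) : ℤ)

variable {G}

theorem sum_sum_eq_of_symm {M : Type*} [AddCommMonoid M] (g : V → V → M)
    (hg : ∀ v w, g v w = g w v) (x : V) (hx : g x x = 0) :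
    ∑ v, ∑ w, g v w = 2 • ∑ w, g x w + ∑ v ∈ univ.erase x, ∑ w ∈ univ.erase x, g v w := by
  have hrow (v : V) : ∑ w, g v w = g x v + ∑ w ∈ univ.erase x, g v w := by
    rw [← add_sum_erase univ _ (mem_univ x), hg v x]
  have hx' : ∑ w, g x w = ∑ w ∈ univ.erase x, g x w := by
    rw [← add_sum_erase univ _ (mem_univ x), hx, zero_add]
  rw [← add_sum_erase univ _ (mem_univ x), sum_congr rfl fun v _ => hrow v, sum_add_distrib,
    ← hx', two_nsmul, add_assoc]

theorem potential_eq (r : Bool → ℕ) (σ : V → Bool) (x : V) :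
    potential G r σ = 2 * (degreeIn G (side σ (σ x)) x - r (σ x)) +
      ((∑ v ∈ univ.erase x, ∑ w ∈ univ.erase x, if G.Adj v w ∧ σ w = σ v then 1 else 0) -
        2 * ∑ v ∈ univ.erase x, (r (σ v) : ℤ)) := by
  have hdeg (v : V) : (degreeIn G (side σ (σ v)) v : ℤ) =
      ∑ w, if G.Adj v w ∧ σ w = σ v then 1 else 0 := by
    simp [degreeIn, side, filter_filter, and_comm]
  rw [potential, sum_congr rfl fun v _ => hdeg v,
    sum_sum_eq_of_symm _ (fun v w => by simp [G.adj_comm v w, eq_comm]) x (by simp), ← hdeg,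
    ← add_sum_erase univ _ (mem_univ x)]
  ring

theorem potential_switch_sub (r : Bool → ℕ) (σ : V → Bool) (x : V) :
    potential G r (switch σ x) - potential G r σ =
      2 * ((degreeIn G (side σ (!σ x)) x - r (!σ x) : ℤ) -
        (degreeIn G (side σ (σ x)) x - r (σ x))) := by
  have hpairs : (∑ v ∈ univ.erase x, ∑ w ∈ univ.erase x,
        if G.Adj v w ∧ switch σ x w = switch σ x v then (1 : ℤ) else 0) =
      ∑ v ∈ univ.erase x, ∑ w ∈ univ.erase x, if G.Adj v w ∧ σ w = σ v then 1 else 0 :=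
    sum_congr rfl fun v hv => sum_congr rfl fun w hw => by
      rw [switch_of_ne σ (ne_of_mem_erase hv), switch_of_ne σ (ne_of_mem_erase hw)]
  have hweights : ∑ v ∈ univ.erase x, (r (switch σ x v) : ℤ) = ∑ v ∈ univ.erase x, (r (σ v) : ℤ) :=
    sum_congr rfl fun v hv => by rw [switch_of_ne σ (ne_of_mem_erase hv)]
  have hdeg : degreeIn G (side (switch σ x) (!σ x)) x = degreeIn G (side σ (!σ x)) x := by
    rw [← degreeIn_erase_self, erase_side_switch, degreeIn_erase_self]
  rw [potential_eq r (switch σ x) x, potential_eq r σ x, hpairs, hweights, switch_self, hdeg]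
  ring

variable (G) in
/-- The partition `σ` minimises the potential. -/
def HasMinPotential (r : Bool → ℕ) (σ : V → Bool) : Prop :=
  ∀ τ, potential G r σ ≤ potential G r τ

end Potential

section Obstruction

variable (G : SimpleGraph V) {r : Bool → ℕ} {σ : V → Bool} {A : Finset V} {v w x : V}

/-- `A` lies on one side `b` of the partition `σ` and is critical for `r b` colours, so that it
obstructs colouring side `b` with `r b` colours. -/
def IsObstruction (r : Bool → ℕ) (σ : V → Bool) (A : Finset V) : Prop :=
  ∃ b, A ⊆ side σ b ∧ IsCritical G A (r b)

open Classical in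
/-- The set of all obstructions of the partition `σ`. -/
noncomputable def obstructions (r : Bool → ℕ) (σ : V → Bool) : Finset (Finset V) :=
  {A | IsObstruction G r σ A}

variable {G}

@[simp] theorem mem_obstructions : A ∈ obstructions G r σ ↔ IsObstruction G r σ A := by
  simp [obstructions]

theorem IsObstruction.subset_side (hA : IsObstruction G r σ A) (hv : v ∈ A) :
    A ⊆ side σ (σ v) := by
  obtain ⟨b, hb, -⟩ := hA
  rwa [mem_side.1 (hb hv)]

theorem IsObstruction.isCritical (hA : IsObstruction G r σ A) (hv : v ∈ A) :
    IsCritical G A (r (σ v)) := by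
  obtain ⟨b, hb, hcrit⟩ := hA
  rwa [mem_side.1 (hb hv)]

theorem IsObstruction.side_eq (hA : IsObstruction G r σ A) (hv : v ∈ A) (hw : w ∈ A) :
    σ v = σ w :=
  mem_side.1 (hA.subset_side hw hv)

theorem isObstruction_switch_iff (hx : x ∉ A) :
    IsObstruction G r (switch σ x) A ↔ IsObstruction G r σ A := by
  refine exists_congr fun b => and_congr_left fun _ => forall₂_congr fun v hv => ?_
  rw [mem_side, mem_side, switch_of_ne σ (ne_of_mem_of_not_mem hv hx)]

theorem filter_notMem_obstructions_switch :
    {S ∈ obstructions G r (switch σ x) | x ∉ S} = {S ∈ obstructions G r σ | x ∉ S} := by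
  ext S
  simp +contextual [isObstruction_switch_iff]

variable (G) in
/-- The partition `σ` has minimum potential and, subject to that, as few obstructions as
possible. -/
structure IsOptimal [DecidableRel G.Adj] (r : Bool → ℕ) (σ : V → Bool) : Prop where
  hasMinPotential : HasMinPotential G r σ
  card_obstructions_le : ∀ τ, HasMinPotential G r τ →
    #(obstructions G r σ) ≤ #(obstructions G r τ)

variable (G) in
theorem exists_isOptimal [DecidableRel G.Adj] (r : Bool → ℕ) : ∃ σ, IsOptimal G r σ := by
  classical
  obtain ⟨σ₀, -, h₀⟩ := exists_min_image (univ : Finset (V → Bool)) (potential G r) univ_nonempty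
  obtain ⟨σ, hσ, h⟩ := exists_min_image ({σ | HasMinPotential G r σ} : Finset (V → Bool))
    (fun σ => #(obstructions G r σ))
      ⟨σ₀, mem_filter.2 ⟨mem_univ σ₀, fun τ => h₀ τ (mem_univ τ)⟩⟩
  exact ⟨σ, (mem_filter.1 hσ).2, fun τ hτ => h τ (mem_filter.2 ⟨mem_univ τ, hτ⟩)⟩

end Obstruction

end Partition

section OreSplit

variable {V : Type*} [Fintype V] (G : SimpleGraph V) [DecidableRel G.Adj] {n : ℕ}
  {r : Bool → ℕ} {σ : V → Bool} {A B F : Finset V} {v w x y z : V}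

/-- `G` is `(n + 1)`-vertex-critical of Ore-degree at most `2n + 1`. -/
structure IsOreCritical [DecidableEq V] (n : ℕ) : Prop where
  isCritical : IsCritical G univ n
  degree_add_degree_le : ∀ ⦃v w⦄, G.Adj v w → G.degree v + G.degree w ≤ 2 * n + 1

/-- An Ore-critical graph together with a splitting of its `n` colours into `r false` colours for
one side of a partition and `r true` for the other, at least two each. -/
structure IsOreSplit [DecidableEq V] (n : ℕ) (r : Bool → ℕ) : Prop extends IsOreCritical G n where
  add_not : ∀ b, r b + r (!b) = n
  two_le : ∀ b, 2 ≤ r b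

variable {G} [DecidableEq V]

namespace IsOreCritical

theorem le_degree (hG : IsOreCritical G n) (v : V) : n ≤ G.degree v :=
  degreeIn_univ (G := G) v ▸ hG.isCritical.le_degreeIn (mem_univ v)

theorem degree_le (hG : IsOreCritical G n) (v : V) : G.degree v ≤ n + 1 := by
  by_contra! hlt
  obtain ⟨w, hw⟩ := (G.degree_pos_iff_exists_adj v).1 (by omega)
  have := hG.degree_add_degree_le hw
  have := hG.le_degree w
  omega

theorem degree_eq_or_degree_eq (hG : IsOreCritical G n) (h : G.Adj v w) :
    G.degree v = n ∨ G.degree w = n := by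
  have := hG.degree_add_degree_le h
  have := hG.le_degree v
  have := hG.le_degree w
  omega

theorem colorableOn_two (hG : IsOreCritical G n)
    (h : ∀ v ∈ A, ∀ w ∈ A, G.Adj v w → G.degree v = n → G.degree w ≠ n) : ColorableOn G A 2 := by
  refine ⟨fun v => if G.degree v = n then 0 else 1, fun v hv w hw hvw => ?_⟩
  have hlow := hG.degree_eq_or_degree_eq hvw
  have hboth := h v hv w hw hvw
  by_cases hdv : G.degree v = n <;> by_cases hdw : G.degree w = n <;> simp_all

end IsOreCritical

namespace IsOreSplit

theorem degreeIn_side_le (hG : IsOreSplit G n r) (hσ : HasMinPotential G r σ) (v : V) :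
    degreeIn G (side σ (σ v)) v ≤ r (σ v) := by
  have hswitch := potential_switch_sub (G := G) r σ v
  have hmin := hσ (switch σ v)
  have hsum := degreeIn_side_add_degreeIn_side_not (G := G) σ (σ v) v
  have hdeg := hG.degree_le v
  have hr := hG.add_not (σ v)
  omega

theorem exists_isObstruction (hG : IsOreSplit G n r) (σ : V → Bool) :
    ∃ A, IsObstruction G r σ A := by
  by_contra! h
  have hcol (b : Bool) : ColorableOn G (side σ b) (r b) := by
    by_contra hb
    obtain ⟨A, hAb, hA⟩ := exists_isCritical_of_not_colorableOn hb
    exact h A ⟨b, hAb, hA⟩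
  have huniv := (hcol true).union (hcol !true)
  rw [side_union_side_not, hG.add_not] at huniv
  exact hG.isCritical.not_colorableOn huniv

theorem exists_adj_degree_eq (hG : IsOreSplit G n r) (hA : IsObstruction G r σ A) :
    ∃ p ∈ A, ∃ q ∈ A, G.Adj p q ∧ G.degree p = n ∧ G.degree q = n := by
  obtain ⟨b, -, hcrit⟩ := hA
  by_contra! h
  exact hcrit.not_colorableOn ((hG.colorableOn_two h).mono_right (hG.two_le b))

theorem degreeIn_side_eq (hG : IsOreSplit G n r) (hσ : HasMinPotential G r σ)
    (hA : IsObstruction G r σ A) (hv : v ∈ A) : degreeIn G (side σ (σ v)) v = r (σ v) :=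
  (hG.degreeIn_side_le hσ v).antisymm
    (((hA.isCritical hv).le_degreeIn hv).trans (degreeIn_mono (hA.subset_side hv) v))

theorem degreeIn_eq (hG : IsOreSplit G n r) (hσ : HasMinPotential G r σ)
    (hA : IsObstruction G r σ A) (hv : v ∈ A) : degreeIn G A v = r (σ v) :=
  ((degreeIn_mono (hA.subset_side hv) v).trans (hG.degreeIn_side_le hσ v)).antisymm
    ((hA.isCritical hv).le_degreeIn hv)

theorem isComponentIn (hG : IsOreSplit G n r) (hσ : HasMinPotential G r σ)
    (hA : IsObstruction G r σ A) (hv : v ∈ A) : IsComponentIn G (side σ (σ v)) A where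
  subset := hA.subset_side hv
  mem_of_adj := by
    intro x hx w hw hxw
    have hnbrs : {w ∈ A | G.Adj x w} = {w ∈ side σ (σ v) | G.Adj x w} := by
      rw [hA.side_eq hv hx]
      refine eq_of_subset_of_card_le (filter_subset_filter _ (hA.subset_side hx)) ?_
      exact ((hG.degreeIn_side_eq hσ hA hx).trans (hG.degreeIn_eq hσ hA hx).symm).le
    exact mem_of_mem_filter w (hnbrs ▸ mem_filter.2 ⟨hw, hxw⟩)
  connectedOn := (hA.isCritical hv).connectedOn

theorem mem_of_adj (hG : IsOreSplit G n r) (hσ : HasMinPotential G r σ)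
    (hA : IsObstruction G r σ A) (hv : v ∈ A) (hvw : G.Adj v w) (hw : σ w = σ v) : w ∈ A :=
  (hG.isComponentIn hσ hA hv).mem_of_adj hv (mem_side.2 hw) hvw

theorem mem_of_adj_of_switch (hG : IsOreSplit G n r) (hσ : HasMinPotential G r (switch σ x))
    (hF : IsObstruction G r (switch σ x) F) (hx : x ∈ F) (hxy : G.Adj x y) (hy : σ y = !σ x) :
    y ∈ F :=
  hG.mem_of_adj hσ hF hx hxy (by rw [switch_of_ne σ hxy.ne', hy, switch_self])

theorem isComponentIn_erase (hG : IsOreSplit G n r) (hσ : HasMinPotential G r σ)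
    (hA : IsObstruction G r σ A) (hx : x ∈ A) :
    IsComponentIn G ((side σ (σ x)).erase x) (A.erase x) where
  toIsClosedIn := (hG.isComponentIn hσ hA hx).toIsClosedIn.erase x
  connectedOn := (hA.isCritical hx).connectedOn_erase hx

theorem isComponentIn_erase_of_switch (hG : IsOreSplit G n r)
    (hσ : HasMinPotential G r (switch σ x)) (hF : IsObstruction G r (switch σ x) F) (hx : x ∈ F) :
    IsComponentIn G (side σ !σ x) (F.erase x) := by
  have h := hG.isComponentIn_erase hσ hF hx
  rwa [switch_self, erase_side_switch, erase_side_not] at h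

theorem obstruction_eq_of_mem_of_mem (hG : IsOreSplit G n r) (hσ : HasMinPotential G r σ)
    (hA : IsObstruction G r σ A) (hB : IsObstruction G r σ B) (hvA : v ∈ A) (hvB : v ∈ B) :
    A = B :=
  (hG.isComponentIn hσ hA hvA).eq_of_mem_of_mem (hG.isComponentIn hσ hB hvB) hvA hvB

theorem erase_eq_erase_of_switch (hG : IsOreSplit G n r) (hxy : σ x = σ y)
    (hσx : HasMinPotential G r (switch σ x)) (hA : IsObstruction G r (switch σ x) A) (hx : x ∈ A)
    (hσy : HasMinPotential G r (switch σ y)) (hB : IsObstruction G r (switch σ y) B) (hy : y ∈ B)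
    (hzA : z ∈ A.erase x) (hzB : z ∈ B.erase y) : A.erase x = B.erase y :=
  (hG.isComponentIn_erase_of_switch hσx hA hx).eq_of_mem_of_mem
    (hxy ▸ hG.isComponentIn_erase_of_switch hσy hB hy) hzA hzB

theorem hasMinPotential_switch (hG : IsOreSplit G n r) (hσ : HasMinPotential G r σ)
    (hA : IsObstruction G r σ A) (hx : x ∈ A) (hlow : G.degree x = n) :
    HasMinPotential G r (switch σ x) := by
  intro τ
  have hswitch := potential_switch_sub (G := G) r σ x
  have hside := hG.degreeIn_side_eq hσ hA hx
  have hsum := degreeIn_side_add_degreeIn_side_not (G := G) σ (σ x) x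
  have hr := hG.add_not (σ x)
  have hmin := hσ τ
  omega

theorem card_obstructions (hG : IsOreSplit G n r) (hσ : HasMinPotential G r σ)
    (hA : IsObstruction G r σ A) (hx : x ∈ A) :
    #(obstructions G r σ) = #{S ∈ obstructions G r σ | x ∉ S} + 1 := by
  have hmem : {S ∈ obstructions G r σ | x ∈ S} = {A} := by
    ext S
    rw [mem_filter, mem_obstructions, mem_singleton]
    refine ⟨fun h => hG.obstruction_eq_of_mem_of_mem hσ h.1 hA h.2 hx, ?_⟩
    rintro rfl
    exact ⟨hA, hx⟩
  rw [← card_filter_add_card_filter_not (fun S => x ∈ S), hmem, card_singleton, add_comm]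

theorem exists_isObstruction_switch (hG : IsOreSplit G n r) (hσ : IsOptimal G r σ)
    (hA : IsObstruction G r σ A) (hx : x ∈ A) (hlow : G.degree x = n) :
    ∃ F, IsObstruction G r (switch σ x) F ∧ x ∈ F := by
  by_contra! h
  have hmin := hG.hasMinPotential_switch hσ.hasMinPotential hA hx hlow
  have hle := hσ.card_obstructions_le _ hmin
  rw [hG.card_obstructions hσ.hasMinPotential hA hx, ← filter_notMem_obstructions_switch,
    filter_true_of_mem fun S hS => h S (mem_obstructions.1 hS)] at hle
  omega

theorem isOptimal_switch (hG : IsOreSplit G n r) (hσ : IsOptimal G r σ)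
    (hA : IsObstruction G r σ A) (hx : x ∈ A) (hlow : G.degree x = n) :
    IsOptimal G r (switch σ x) := by
  have hmin := hG.hasMinPotential_switch hσ.hasMinPotential hA hx hlow
  obtain ⟨F, hF, hxF⟩ := hG.exists_isObstruction_switch hσ hA hx hlow
  refine ⟨hmin, fun τ hτ => le_trans (le_of_eq ?_) (hσ.card_obstructions_le τ hτ)⟩
  rw [hG.card_obstructions hmin hF hxF, filter_notMem_obstructions_switch,
    ← hG.card_obstructions hσ.hasMinPotential hA hx]

end IsOreSplit

end OreSplit

section Walk

variable {V : Type*} [Fintype V] [DecidableEq V] (G : SimpleGraph V) [DecidableRel G.Adj]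

/-- An optimal partition, one of its obstructions, and an edge `pq` of that obstruction joining two
vertices of degree `n`; the vertex `q` is the next one to change sides. -/
structure Stage (n : ℕ) (r : Bool → ℕ) where
  σ : V → Bool
  A : Finset V
  p : V
  q : V
  isOptimal : IsOptimal G r σ
  isObstruction : IsObstruction G r σ A
  p_mem : p ∈ A
  q_mem : q ∈ A
  adj : G.Adj p q
  degree_p : G.degree p = n
  degree_q : G.degree q = n

variable {G} {n : ℕ} {r : Bool → ℕ}

namespace Stage

/-- The part of the obstruction that stays behind when `q` changes sides. -/
def rest (s : Stage G n r) : Finset V := s.A.erase s.q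

theorem p_mem_rest (s : Stage G n r) : s.p ∈ s.rest := mem_erase.2 ⟨s.adj.ne, s.p_mem⟩

theorem insert_q_rest (s : Stage G n r) : insert s.q s.rest = s.A := insert_erase s.q_mem

theorem σ_q (s : Stage G n r) : s.σ s.q = s.σ s.p := s.isObstruction.side_eq s.q_mem s.p_mem

theorem hasMinPotential (s : Stage G n r) : HasMinPotential G r s.σ := s.isOptimal.hasMinPotential

theorem hasMinPotential_switch_p (s : Stage G n r) (hG : IsOreSplit G n r) :
    HasMinPotential G r (switch s.σ s.p) :=
  hG.hasMinPotential_switch s.hasMinPotential s.isObstruction s.p_mem s.degree_p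

end Stage

theorem IsOreSplit.exists_stage (hG : IsOreSplit G n r) : Nonempty (Stage G n r) := by
  obtain ⟨σ, hσ⟩ := exists_isOptimal G r
  obtain ⟨A, hA⟩ := hG.exists_isObstruction σ
  obtain ⟨p, hp, q, hq, hpq, hdp, hdq⟩ := hG.exists_adj_degree_eq hA
  exact ⟨⟨σ, A, p, q, hσ, hA, hp, hq, hpq, hdp, hdq⟩⟩

/-- In the sequence `S` of stages, each stage arises by moving the vertex `q` of the previous one to
the other side, into the obstruction of the new stage; that vertex is not moved straight back. -/
structure IsWalk (S : ℕ → Stage G n r) : Prop where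
  σ_succ : ∀ i, (S (i + 1)).σ = switch (S i).σ (S i).q
  q_mem_succ : ∀ i, (S i).q ∈ (S (i + 1)).A
  q_succ_ne : ∀ i, (S (i + 1)).q ≠ (S i).q

theorem IsOreSplit.exists_next (hG : IsOreSplit G n r) (s : Stage G n r) :
    ∃ s' : Stage G n r, s'.σ = switch s.σ s.q ∧ s.q ∈ s'.A ∧ s'.q ≠ s.q := by
  have hopt := hG.isOptimal_switch s.isOptimal s.isObstruction s.q_mem s.degree_q
  obtain ⟨A, hA, hqA⟩ :=
    hG.exists_isObstruction_switch s.isOptimal s.isObstruction s.q_mem s.degree_q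
  obtain ⟨x, hx, y, hy, hxy, hdx, hdy⟩ := hG.exists_adj_degree_eq hA
  by_cases hyq : y = s.q
  · exact ⟨⟨_, A, y, x, hopt, hA, hy, hx, hxy.symm, hdy, hdx⟩, rfl, hqA, hyq ▸ hxy.ne⟩
  · exact ⟨⟨_, A, x, y, hopt, hA, hx, hy, hxy, hdx, hdy⟩, rfl, hqA, hyq⟩

theorem IsOreSplit.exists_isWalk (hG : IsOreSplit G n r) :
    ∃ S : ℕ → Stage G n r, IsWalk S := by
  obtain ⟨s⟩ := hG.exists_stage
  choose next hσ hmem hne using hG.exists_next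
  have hsucc (i : ℕ) : next^[i + 1] s = next (next^[i] s) := Function.iterate_succ_apply' next i s
  exact ⟨fun i => next^[i] s, fun i => hsucc i ▸ hσ _, fun i => hsucc i ▸ hmem _,
    fun i => hsucc i ▸ hne _⟩

/-- Up to time `k`, no obstruction in the sequence meets what was left behind at an earlier
stage. -/
def NoReturn (S : ℕ → Stage G n r) (k : ℕ) : Prop :=
  ∀ ⦃i j⦄, i < j → j ≤ k → Disjoint (S i).rest (S j).A

variable {S : ℕ → Stage G n r} {i j k m : ℕ} {w x : V} {F : Finset V}

theorem NoReturn.ne_q_of_mem_rest (hk : NoReturn S k) (hx : x ∈ (S j).rest) (hji : j ≤ i)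
    (hik : i ≤ k) : x ≠ (S i).q := by
  rintro rfl
  rcases hji.eq_or_lt with rfl | hlt
  · exact notMem_erase _ _ hx
  · exact disjoint_left.1 (hk hlt hik) hx (S i).q_mem

theorem exists_not_noReturn (S : ℕ → Stage G n r) : ∃ k, ¬ NoReturn S k := by
  by_contra! h
  exact not_injective_infinite_finite (fun i => (S i).p) <| .of_lt_imp_ne fun i j hij hp =>
    disjoint_left.1 (h j hij le_rfl) (S i).p_mem_rest (hp ▸ (S j).p_mem)

/-- The walk `S` returns for the first time at time `k + 1`, and then to what was left behind at
time `j`. -/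
structure IsFirstReturn (S : ℕ → Stage G n r) (j k : ℕ) : Prop extends IsWalk S where
  noReturn : NoReturn S k
  le : j ≤ k
  not_disjoint : ¬ Disjoint (S j).rest (S (k + 1)).A

namespace IsWalk

theorem exists_isFirstReturn (hS : IsWalk S) : ∃ j k, IsFirstReturn S j k := by
  classical
  obtain ⟨k, hk, hreturn⟩ : ∃ k, NoReturn S k ∧ ¬ NoReturn S (k + 1) := by
    by_contra! h
    obtain ⟨k, hk⟩ := exists_not_noReturn S
    exact hk (Nat.rec (fun i j hij hj => (hij.not_ge (hj.trans i.zero_le)).elim) h k)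
  simp only [NoReturn, not_forall] at hreturn
  obtain ⟨i, j, hij, hj, hmeet⟩ := hreturn
  obtain rfl : j = k + 1 := by
    by_contra hne
    exact hmeet (hk hij (by omega))
  exact ⟨i, k, hS, hk, by omega, hmeet⟩

theorem q_mem_rest (hS : IsWalk S) (i : ℕ) : (S i).q ∈ (S (i + 1)).rest :=
  mem_erase.2 ⟨(hS.q_succ_ne i).symm, hS.q_mem_succ i⟩

theorem σ_succ_q (hS : IsWalk S) (i : ℕ) : (S (i + 1)).σ (S i).q = !(S i).σ (S i).q := by
  rw [hS.σ_succ, switch_self]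

theorem σ_eq_of_ne (hS : IsWalk S) (hjm : j ≤ m) (hx : ∀ i, j ≤ i → i < m → x ≠ (S i).q) :
    (S m).σ x = (S j).σ x := by
  induction m, hjm using Nat.le_induction with
  | base => rfl
  | succ m hjm ih =>
    rw [hS.σ_succ, switch_of_ne _ (hx m hjm m.lt_succ_self)]
    exact ih fun i hji him => hx i hji (by omega)

theorem σ_eq_of_mem_rest (hS : IsWalk S) (hk : NoReturn S k) (hx : x ∈ (S j).rest) (hjm : j ≤ m)
    (hmk : m ≤ k + 1) : (S m).σ x = (S j).σ x :=
  hS.σ_eq_of_ne hjm fun _ hji him => hk.ne_q_of_mem_rest hx hji (by omega)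

theorem σ_eq_σ_q_of_mem_rest (hS : IsWalk S) (hk : NoReturn S k) (hx : x ∈ (S j).rest)
    (hjm : j ≤ m) (hmk : m ≤ k + 1) : (S m).σ x = (S j).σ (S j).q :=
  (hS.σ_eq_of_mem_rest hk hx hjm hmk).trans
    ((S j).isObstruction.side_eq (mem_of_mem_erase hx) (S j).q_mem)

theorem ne_q_of_adj_of_mem_rest (hS : IsWalk S) (hG : IsOreSplit G n r) (hk : NoReturn S k)
    (hx : x ∈ (S j).rest) (hxw : G.Adj x w) (hw : (S (k + 1)).σ w = (S j).σ (S j).q)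
    (hwk : w ≠ (S k).q) (hji : j ≤ i) (hik : i ≤ k) : w ≠ (S i).q := by
  rintro rfl
  have hik' : i ≠ k := fun h => hwk (h ▸ rfl)
  -- Otherwise `x` would have returned to an obstruction together with `w`, right after `w` moved.
  refine disjoint_left.1 (hk (show j < i + 1 by omega) (by omega)) hx
    (hG.mem_of_adj (S (i + 1)).hasMinPotential (S (i + 1)).isObstruction (hS.q_mem_succ i)
      hxw.symm ?_)
  rw [hS.σ_eq_σ_q_of_mem_rest hk hx (by omega) (by omega), ← hw,
    hS.σ_eq_of_mem_rest hk (hS.q_mem_rest i) (by omega) le_rfl]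

theorem isComponentIn_rest (hS : IsWalk S) (hG : IsOreSplit G n r) (hk : NoReturn S k)
    (hjk : j ≤ k) :
    IsComponentIn G ((side (S (k + 1)).σ ((S j).σ (S j).q)).erase (S k).q) (S j).rest where
  subset x hx := mem_erase.2 ⟨hk.ne_q_of_mem_rest hx hjk le_rfl,
    mem_side.2 (hS.σ_eq_σ_q_of_mem_rest hk hx (by omega) le_rfl)⟩
  mem_of_adj := by
    intro x hx w hw hxw
    obtain ⟨hwk, hwσ⟩ := mem_erase.1 hw
    rw [mem_side] at hwσ
    have hne : ∀ i, j ≤ i → i < k + 1 → w ≠ (S i).q := fun i hji hik =>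
      hS.ne_q_of_adj_of_mem_rest hG hk hx hxw hwσ hwk hji (by omega)
    refine mem_erase.2 ⟨hne j le_rfl (by omega), hG.mem_of_adj (S j).hasMinPotential
      (S j).isObstruction (mem_of_mem_erase hx) hxw ?_⟩
    rw [← hS.σ_eq_of_ne (by omega) hne, hwσ, hS.σ_eq_σ_q_of_mem_rest hk hx le_rfl (by omega)]
  connectedOn := ((S j).isObstruction.isCritical (S j).q_mem).connectedOn_erase (S j).q_mem

end IsWalk

namespace IsFirstReturn

theorem σ_q_eq (hS : IsFirstReturn S j k) : (S (k + 1)).σ (S k).q = (S j).σ (S j).q := by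
  obtain ⟨x, hx, hxA⟩ := not_disjoint_iff.1 hS.not_disjoint
  rw [← hS.σ_eq_σ_q_of_mem_rest hS.noReturn hx (hS.le.trans k.le_succ) le_rfl,
    (S (k + 1)).isObstruction.side_eq (hS.q_mem_succ k) hxA]

theorem lt (hS : IsFirstReturn S j k) : j < k := by
  refine hS.le.lt_of_ne ?_
  rintro rfl
  exact Bool.not_ne_self _ ((hS.σ_succ_q j).symm.trans hS.σ_q_eq)

theorem erase_eq_rest (hS : IsFirstReturn S j k) (hG : IsOreSplit G n r) :
    (S (k + 1)).A.erase (S k).q = (S j).rest := by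
  obtain ⟨x, hx, hxA⟩ := not_disjoint_iff.1 hS.not_disjoint
  have hnew := hG.isComponentIn_erase (S (k + 1)).hasMinPotential (S (k + 1)).isObstruction
    (hS.q_mem_succ k)
  rw [hS.σ_q_eq] at hnew
  exact hnew.eq_of_mem_of_mem (hS.isComponentIn_rest hG hS.noReturn hS.le)
    (mem_erase.2 ⟨hS.noReturn.ne_q_of_mem_rest hx hS.le le_rfl, hxA⟩) hx

theorem p_mem (hS : IsFirstReturn S j k) (hG : IsOreSplit G n r) : (S j).p ∈ (S (k + 1)).A :=
  mem_of_mem_erase (hS.erase_eq_rest hG ▸ (S j).p_mem_rest)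

theorem hasMinPotential_switch_p (hS : IsFirstReturn S j k) (hG : IsOreSplit G n r) :
    HasMinPotential G r (switch (S (k + 1)).σ (S j).p) :=
  hG.hasMinPotential_switch (S (k + 1)).hasMinPotential (S (k + 1)).isObstruction (hS.p_mem hG)
    (S j).degree_p

theorem σ_p (hS : IsFirstReturn S j k) : (S (k + 1)).σ (S j).p = (S j).σ (S j).p :=
  hS.σ_eq_of_mem_rest hS.noReturn (S j).p_mem_rest (hS.le.trans k.le_succ) le_rfl

theorem σ_q (hS : IsFirstReturn S j k) : (S (k + 1)).σ (S j).q = (S (j + 1)).σ (S j).q :=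
  hS.σ_eq_of_mem_rest hS.noReturn (hS.q_mem_rest j) (by have := hS.le; omega) le_rfl

theorem σ_q_eq_not_σ_p (hS : IsFirstReturn S j k) :
    (S (k + 1)).σ (S j).q = !(S (k + 1)).σ (S j).p := by
  rw [hS.σ_q, hS.σ_succ_q, (S j).σ_q, hS.σ_p]

theorem q_mem_of_switch (hS : IsFirstReturn S j k) (hG : IsOreSplit G n r)
    (hF : IsObstruction G r (switch (S (k + 1)).σ (S j).p) F) (hpF : (S j).p ∈ F) :
    (S j).q ∈ F :=
  hG.mem_of_adj_of_switch (hS.hasMinPotential_switch_p hG) hF hpF (S j).adj hS.σ_q_eq_not_σ_p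

theorem erase_eq_rest_succ (hS : IsFirstReturn S j k) (hG : IsOreSplit G n r)
    (hF : IsObstruction G r (switch (S (k + 1)).σ (S j).p) F) (hpF : (S j).p ∈ F) :
    F.erase (S j).p = (S (j + 1)).rest := by
  have hrest := hS.isComponentIn_rest hG hS.noReturn (Nat.succ_le_of_lt hS.lt)
  have hside : (S (j + 1)).σ (S (j + 1)).q = !(S (k + 1)).σ (S j).p := by
    rw [(S (j + 1)).isObstruction.side_eq (S (j + 1)).q_mem (hS.q_mem_succ j), ← hS.σ_q,
      hS.σ_q_eq_not_σ_p]
  have hk : (S k).q ∉ side (S (k + 1)).σ (!(S (k + 1)).σ (S j).p) := by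
    rw [mem_side, hS.σ_q_eq, (S j).σ_q, hS.σ_p]
    exact (Bool.not_ne_self _).symm
  rw [Nat.succ_eq_add_one, hside, erase_eq_of_notMem hk] at hrest
  exact (hG.isComponentIn_erase_of_switch (hS.hasMinPotential_switch_p hG) hF hpF).eq_of_mem_of_mem
    hrest (mem_erase.2 ⟨(S j).adj.ne', hS.q_mem_of_switch hG hF hpF⟩) (hS.q_mem_rest j)

theorem adj_q_q_succ (hS : IsFirstReturn S j k) (hG : IsOreSplit G n r)
    (hF : IsObstruction G r (switch (S (k + 1)).σ (S j).p) F) (hpF : (S j).p ∈ F) :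
    G.Adj (S j).q (S (j + 1)).q := by
  have hrest := hS.erase_eq_rest_succ hG hF hpF
  have hp : (S j).p ∉ (S (j + 1)).rest := hrest ▸ notMem_erase _ _
  refine (adj_iff_adj_of_degreeIn_insert_eq hp (notMem_erase _ _) ?_).1 (S j).adj.symm
  rw [(S (j + 1)).insert_q_rest, ← hrest, insert_erase hpF,
    hG.degreeIn_eq (hS.hasMinPotential_switch_p hG) hF (hS.q_mem_of_switch hG hF hpF),
    hG.degreeIn_eq (S (j + 1)).hasMinPotential (S (j + 1)).isObstruction (hS.q_mem_succ j),
    switch_of_ne _ (S j).adj.ne', hS.σ_q]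

end IsFirstReturn

/-- `C` lies on the other side of the partition of `s`, and moving either endpoint of the edge `pq`
of `s` there completes `C` to an obstruction; `t` is a neighbour of `q` of degree `n` in `C`. -/
structure IsLinked (s : Stage G n r) (C : Finset V) (t : V) : Prop where
  isObstruction_p : IsObstruction G r (switch s.σ s.p) (insert s.p C)
  isObstruction_q : IsObstruction G r (switch s.σ s.q) (insert s.q C)
  t_mem : t ∈ C
  degree_t : G.degree t = n
  adj : G.Adj s.q t

theorem IsFirstReturn.exists_adj_mem_erase (hS : IsFirstReturn S j k) (hG : IsOreSplit G n r)
    (hF : IsObstruction G r (switch (S (k + 1)).σ (S j).p) F) (hpF : (S j).p ∈ F) :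
    ∃ e ∈ (S (j + 1)).A.erase (S j).q, G.Adj (S j).p e := by
  have hdeg : 1 < #{e ∈ F | G.Adj (S j).p e} :=
    (hG.two_le _).trans_eq (hG.degreeIn_eq (hS.hasMinPotential_switch_p hG) hF hpF).symm
  obtain ⟨e, he, heq⟩ := exists_mem_ne hdeg (S j).q
  obtain ⟨heF, hpe⟩ := mem_filter.1 he
  have heR : e ∈ (S (j + 1)).rest := hS.erase_eq_rest_succ hG hF hpF ▸ mem_erase.2 ⟨hpe.ne', heF⟩
  exact ⟨e, mem_erase.2 ⟨heq, mem_of_mem_erase heR⟩, hpe⟩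

theorem IsFirstReturn.isLinked (hS : IsFirstReturn S j k) (hG : IsOreSplit G n r) :
    IsLinked (S j) ((S (j + 1)).A.erase (S j).q) (S (j + 1)).q := by
  obtain ⟨F, hF, hpF⟩ := hG.exists_isObstruction_switch (S (k + 1)).isOptimal
    (S (k + 1)).isObstruction (hS.p_mem hG) (S j).degree_p
  obtain ⟨e, he, hpe⟩ := hS.exists_adj_mem_erase hG hF hpF
  have hA : IsObstruction G r (switch (S j).σ (S j).q) (S (j + 1)).A :=
    hS.σ_succ j ▸ (S (j + 1)).isObstruction
  have hminA : HasMinPotential G r (switch (S j).σ (S j).q) :=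
    hS.σ_succ j ▸ (S (j + 1)).hasMinPotential
  obtain ⟨D, hD, hpD⟩ := hG.exists_isObstruction_switch (S j).isOptimal (S j).isObstruction
    (S j).p_mem (S j).degree_p
  have hminD := (S j).hasMinPotential_switch_p hG
  have heσ : (S j).σ e = !(S j).σ (S j).p := by
    rw [← switch_of_ne (S j).σ (ne_of_mem_erase he),
      hA.side_eq (mem_of_mem_erase he) (hS.q_mem_succ j), switch_self, (S j).σ_q]
  have heD : e ∈ D := hG.mem_of_adj_of_switch hminD hD hpD hpe heσ
  have hDA : D.erase (S j).p = (S (j + 1)).A.erase (S j).q :=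
    hG.erase_eq_erase_of_switch (S j).σ_q.symm hminD hD hpD hminA hA (hS.q_mem_succ j)
      (mem_erase.2 ⟨hpe.ne', heD⟩) he
  exact ⟨by rwa [← hDA, insert_erase hpD], by rwa [insert_erase (hS.q_mem_succ j)],
    mem_erase.2 ⟨hS.q_succ_ne j, (S (j + 1)).q_mem⟩, (S (j + 1)).degree_q,
    hS.adj_q_q_succ hG hF hpF⟩

theorem IsOreSplit.exists_isLinked (hG : IsOreSplit G n r) :
    ∃ (s : Stage G n r) (C : Finset V) (t : V), IsLinked s C t := by
  obtain ⟨S, hS⟩ := hG.exists_isWalk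
  obtain ⟨j, k, hjk⟩ := hS.exists_isFirstReturn
  exact ⟨S j, _, _, hjk.isLinked hG⟩

end Walk

section Linked

variable {V : Type*} [Fintype V] [DecidableEq V] {G : SimpleGraph V} [DecidableRel G.Adj] {n : ℕ}
  {r : Bool → ℕ} {s : Stage G n r} {C : Finset V} {t x y : V}

namespace Stage

/-- The stage with the roles of `p` and `q` interchanged. -/
def symm (s : Stage G n r) : Stage G n r where
  __ := s
  p := s.q
  q := s.p
  p_mem := s.q_mem
  q_mem := s.p_mem
  adj := s.adj.symm
  degree_p := s.degree_q
  degree_q := s.degree_p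

/-- The stage with `q` replaced by another neighbour of `p` of degree `n` in the same
obstruction. -/
def replaceQ (s : Stage G n r) (x : V) (hx : x ∈ s.A) (hpx : G.Adj s.p x)
    (hlow : G.degree x = n) : Stage G n r where
  __ := s
  q := x
  q_mem := hx
  adj := hpx
  degree_q := hlow

end Stage

namespace IsLinked

theorem p_notMem (h : IsLinked s C t) : s.p ∉ C := fun hp => by
  have := h.isObstruction_q.side_eq (mem_insert_of_mem hp) (mem_insert_self s.q C)
  rw [switch_self, switch_of_ne _ s.adj.ne, s.σ_q] at this
  exact Bool.not_ne_self _ this.symm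

theorem q_notMem (h : IsLinked s C t) : s.q ∉ C := fun hq => by
  have := h.isObstruction_p.side_eq (mem_insert_of_mem hq) (mem_insert_self s.p C)
  rw [switch_self, switch_of_ne _ s.adj.ne', s.σ_q] at this
  exact Bool.not_ne_self _ this.symm

theorem σ_eq_of_mem (h : IsLinked s C t) (hx : x ∈ C) : s.σ x = !s.σ s.p := by
  rw [← switch_of_ne s.σ (ne_of_mem_of_not_mem hx h.p_notMem), ← switch_self,
    h.isObstruction_p.side_eq (mem_insert_of_mem hx) (mem_insert_self s.p C)]

theorem adj_p_iff_adj_q (h : IsLinked s C t) (hG : IsOreSplit G n r) (hx : x ∈ C) :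
    G.Adj x s.p ↔ G.Adj x s.q := by
  have hmin : HasMinPotential G r (switch s.σ s.q) := s.symm.hasMinPotential_switch_p hG
  refine adj_iff_adj_of_degreeIn_insert_eq h.p_notMem h.q_notMem ?_
  rw [hG.degreeIn_eq (s.hasMinPotential_switch_p hG) h.isObstruction_p (mem_insert_of_mem hx),
    hG.degreeIn_eq hmin h.isObstruction_q (mem_insert_of_mem hx),
    switch_of_ne _ (ne_of_mem_of_not_mem hx h.p_notMem),
    switch_of_ne _ (ne_of_mem_of_not_mem hx h.q_notMem)]

theorem adj_p (h : IsLinked s C t) (hG : IsOreSplit G n r) : G.Adj s.p t :=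
  ((h.adj_p_iff_adj_q hG h.t_mem).2 h.adj.symm).symm

theorem symm (h : IsLinked s C t) (hG : IsOreSplit G n r) : IsLinked s.symm C t where
  isObstruction_p := h.isObstruction_q
  isObstruction_q := h.isObstruction_p
  t_mem := h.t_mem
  degree_t := h.degree_t
  adj := h.adj_p hG

/-- The stage reached by moving `p`, with the edge `tp` marked. -/
def next (h : IsLinked s C t) (hG : IsOreSplit G n r) : Stage G n r where
  σ := switch s.σ s.p
  A := insert s.p C
  p := t
  q := s.p
  isOptimal := hG.isOptimal_switch s.isOptimal s.isObstruction s.p_mem s.degree_p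
  isObstruction := h.isObstruction_p
  p_mem := mem_insert_of_mem h.t_mem
  q_mem := mem_insert_self s.p C
  adj := (h.adj_p hG).symm
  degree_p := h.degree_t
  degree_q := s.degree_p

theorem isLinked_next (h : IsLinked s C t) (hG : IsOreSplit G n r) :
    IsLinked (h.next hG) (s.A.erase s.p) s.q where
  isObstruction_p := by
    obtain ⟨T, hT, htT⟩ := hG.exists_isObstruction_switch (h.next hG).isOptimal
      (h.next hG).isObstruction (h.next hG).p_mem (h.next hG).degree_p
    have hqT : s.q ∈ T := hG.mem_of_adj_of_switch ((h.next hG).hasMinPotential_switch_p hG) hT htT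
      h.adj.symm <| by
        rw [(h.next hG).isObstruction.side_eq (h.next hG).p_mem (h.next hG).q_mem]
        simp [next, switch_of_ne _ s.adj.ne', s.σ_q]
    have hTA : T.erase t = s.A.erase s.p :=
      hG.erase_eq_erase_of_switch (h.next hG).σ_q.symm ((h.next hG).hasMinPotential_switch_p hG)
        hT htT (by simpa [next] using s.hasMinPotential)
        (by simpa [next] using s.isObstruction) s.p_mem (mem_erase.2 ⟨h.adj.ne, hqT⟩)
        (mem_erase.2 ⟨s.adj.ne', s.q_mem⟩)
    have htT' : insert t (T.erase t) = T := insert_erase htT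
    rwa [← hTA, show (h.next hG).p = t from rfl, htT']
  isObstruction_q := by simpa [next, insert_erase s.p_mem] using s.isObstruction
  t_mem := mem_erase.2 ⟨s.adj.ne', s.q_mem⟩
  degree_t := s.degree_q
  adj := s.adj

theorem adj_t_iff_adj_p (h : IsLinked s C t) (hG : IsOreSplit G n r) (hx : x ∈ s.A)
    (hxp : x ≠ s.p) : G.Adj x t ↔ G.Adj x s.p :=
  (h.isLinked_next hG).adj_p_iff_adj_q hG (mem_erase.2 ⟨hxp, hx⟩)

theorem mem_or_mem (h : IsLinked s C t) (hG : IsOreSplit G n r) (hpy : G.Adj s.p y) :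
    y ∈ s.A ∨ y ∈ C := by
  by_cases hy : s.σ y = s.σ s.p
  · exact Or.inl (hG.mem_of_adj s.hasMinPotential s.isObstruction s.p_mem hpy hy)
  · exact Or.inr (mem_of_mem_insert_of_ne (hG.mem_of_adj_of_switch (s.hasMinPotential_switch_p hG)
      h.isObstruction_p (mem_insert_self s.p C) hpy (Bool.eq_not_of_ne hy)) hpy.ne')

theorem adj_q_of_adj_p (h : IsLinked s C t) (hG : IsOreSplit G n r) (hpy : G.Adj s.p y)
    (hyq : y ≠ s.q) : G.Adj s.q y := by
  rcases h.mem_or_mem hG hpy with hyA | hyC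
  · exact (((h.symm hG).adj_t_iff_adj_p hG hyA hyq).1
      ((h.adj_t_iff_adj_p hG hyA hpy.ne').2 hpy.symm)).symm
  · exact ((h.adj_p_iff_adj_q hG hyC).1 hpy.symm).symm

theorem adj_t_of_adj_p (h : IsLinked s C t) (hG : IsOreSplit G n r) (hpy : G.Adj s.p y)
    (hyt : y ≠ t) : G.Adj t y :=
  ((h.isLinked_next hG).symm hG).adj_q_of_adj_p hG hpy hyt

theorem replaceQ (h : IsLinked s C t) (hG : IsOreSplit G n r) (hx : x ∈ s.A)
    (hpx : G.Adj s.p x) (hlow : G.degree x = n) : IsLinked (s.replaceQ x hx hpx hlow) C t where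
  isObstruction_p := h.isObstruction_p
  isObstruction_q := by
    have hxt : G.Adj x t := (h.adj_t_iff_adj_p hG hx hpx.ne').2 hpx.symm
    have hxσ : s.σ x = s.σ s.p := s.isObstruction.side_eq hx s.p_mem
    have hmin := hG.hasMinPotential_switch s.hasMinPotential s.isObstruction hx hlow
    obtain ⟨F, hF, hxF⟩ := hG.exists_isObstruction_switch s.isOptimal s.isObstruction hx hlow
    have htF : t ∈ F := hG.mem_of_adj_of_switch hmin hF hxF hxt (hxσ ▸ h.σ_eq_of_mem h.t_mem)
    have hFC : F.erase x = (insert s.p C).erase s.p :=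
      hG.erase_eq_erase_of_switch hxσ hmin hF hxF (s.hasMinPotential_switch_p hG)
        h.isObstruction_p (mem_insert_self s.p C) (mem_erase.2 ⟨hxt.ne', htF⟩)
        (mem_erase.2 ⟨ne_of_mem_of_not_mem h.t_mem h.p_notMem, mem_insert_of_mem h.t_mem⟩)
    rw [erase_insert h.p_notMem] at hFC
    rw [← hFC, show (s.replaceQ x hx hpx hlow).q = x from rfl, insert_erase hxF]
    exact hF
  t_mem := h.t_mem
  degree_t := h.degree_t
  adj := (h.adj_t_iff_adj_p hG hx hpx.ne').2 hpx.symm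

theorem replaceT (h : IsLinked s C t) (hG : IsOreSplit G n r) (hx : x ∈ C) (hpx : G.Adj s.p x)
    (hlow : G.degree x = n) : IsLinked s C x where
  __ := h
  t_mem := hx
  degree_t := hlow
  adj := ((h.adj_p_iff_adj_q hG hx).1 hpx.symm).symm

theorem adj_of_degree_eq (h : IsLinked s C t) (hG : IsOreSplit G n r) (hpx : G.Adj s.p x)
    (hlow : G.degree x = n) (hpy : G.Adj s.p y) (hyx : y ≠ x) : G.Adj x y := by
  rcases h.mem_or_mem hG hpx with hxA | hxC
  · exact (h.replaceQ hG hxA hpx hlow).adj_q_of_adj_p hG hpy hyx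
  · exact (h.replaceT hG hxC hpx hlow).adj_t_of_adj_p hG hpy hyx

end IsLinked

end Linked

section Clique

variable {V α : Type*} (G : SimpleGraph V) [DecidableRel G.Adj]

/-- The colours that the colouring `c` does not use on the neighbours of `w` in `S`. -/
def freeColors [Fintype α] [DecidableEq α] (c : V → α) (S : Finset V) (w : V) : Finset α :=
  ({x ∈ S | G.Adj w x}.image c)ᶜ

variable {G} in
theorem card_sub_degreeIn_le_card_freeColors [Fintype α] [DecidableEq α] (c : V → α)
    (S : Finset V) (w : V) : Fintype.card α - degreeIn G S w ≤ #(freeColors G c S w) := by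
  rw [freeColors, card_compl]
  exact Nat.sub_le_sub_left card_image_le _

variable [Fintype V]

/-- The neighbours of `p` of degree different from `n`; in an Ore-critical graph these have degree
`n + 1`. -/
def highNeighborFinset (n : ℕ) (p : V) : Finset V := {x ∈ G.neighborFinset p | G.degree x ≠ n}

/-- The vertex `p` has degree `n`, and so do at least two of its neighbours; all such neighbours are
twins of `p`, in that they are adjacent to every other neighbour of `p`. -/
structure HasLowTwins (n : ℕ) (p : V) : Prop where
  degree_eq : G.degree p = n
  one_lt_card : 1 < #{x ∈ G.neighborFinset p | G.degree x = n}
  adj_of_degree_eq : ∀ ⦃x⦄, G.Adj p x → G.degree x = n → ∀ ⦃y⦄, G.Adj p y → y ≠ x → G.Adj x y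

/-- The closed neighbourhood `N[p]`. -/
def closedNeighborFinset [DecidableEq V] (p : V) : Finset V := insert p (G.neighborFinset p)

variable {G} {n : ℕ} {p q w w₁ w₂ x : V}

theorem mem_highNeighborFinset : x ∈ highNeighborFinset G n p ↔ G.Adj p x ∧ G.degree x ≠ n := by
  simp [highNeighborFinset]

theorem HasLowTwins.card_highNeighborFinset_add_two_le (hp : HasLowTwins G n p) :
    #(highNeighborFinset G n p) + 2 ≤ n := by
  have hsum : #{x ∈ G.neighborFinset p | G.degree x = n} + #(highNeighborFinset G n p) =
      #(G.neighborFinset p) := card_filter_add_card_filter_not _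
  rw [G.card_neighborFinset_eq_degree, hp.degree_eq] at hsum
  have hlow := hp.one_lt_card
  omega

theorem HasLowTwins.exists_adj_degree_eq (hp : HasLowTwins G n p) :
    ∃ q, G.Adj p q ∧ G.degree q = n := by
  obtain ⟨q, hq⟩ := card_pos.1 (zero_lt_one.trans hp.one_lt_card)
  exact ⟨q, by simpa using hq⟩

theorem lt_mul_sub {h n : ℕ} (hn : 5 ≤ n) (h₂ : 2 ≤ h) (hh : h + 2 ≤ n) : n < h * (n - h) := by
  obtain ⟨a, rfl⟩ := Nat.exists_eq_add_of_le h₂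
  obtain ⟨b, rfl⟩ := Nat.exists_eq_add_of_le hh
  rw [show 2 + a + 2 + b - (2 + a) = 2 + b by omega]
  nlinarith [Nat.zero_le (a * b)]

theorem card_mul_le_card_of_pairwiseDisjoint {ι : Type*} [Fintype α] {s : Finset ι}
    {f : ι → Finset α} (hf : (s : Set ι).PairwiseDisjoint f) {m : ℕ} (hm : ∀ i ∈ s, m ≤ #(f i)) :
    #s * m ≤ Fintype.card α := by
  classical
  calc #s * m ≤ ∑ i ∈ s, #(f i) := card_nsmul_le_sum s _ m hm
    _ = #(s.biUnion f) := (card_biUnion hf).symm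
    _ ≤ Fintype.card α := card_le_univ _

variable [DecidableEq V]

theorem mem_closedNeighborFinset : x ∈ closedNeighborFinset G p ↔ x = p ∨ G.Adj p x := by
  simp [closedNeighborFinset]

theorem card_closedNeighborFinset (p : V) : #(closedNeighborFinset G p) = G.degree p + 1 := by
  rw [closedNeighborFinset, card_insert_of_notMem (by simp), G.card_neighborFinset_eq_degree]

theorem highNeighborFinset_subset : highNeighborFinset G n p ⊆ closedNeighborFinset G p :=
  (filter_subset _ _).trans (subset_insert _ _)

theorem IsOreSplit.exists_hasLowTwins {r : Bool → ℕ} (hG : IsOreSplit G n r) :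
    ∃ p, HasLowTwins G n p := by
  obtain ⟨s, C, t, h⟩ := hG.exists_isLinked
  refine ⟨s.p, s.degree_p, one_lt_card.2 ⟨s.q, ?_, t, ?_, h.adj.ne⟩,
    fun x hpx hx y hpy hyx => h.adj_of_degree_eq hG hpx hx hpy hyx⟩
  · simp [s.adj, s.degree_q]
  · simp [h.adj_p hG, h.degree_t]

theorem HasLowTwins.le_degreeIn_closedNeighborFinset (hp : HasLowTwins G n p)
    (hw : w ∈ highNeighborFinset G n p) :
    n + 1 - #(highNeighborFinset G n p) ≤ degreeIn G (closedNeighborFinset G p) w := by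
  obtain ⟨hpw, hwn⟩ := mem_highNeighborFinset.1 hw
  rw [← hp.degree_eq, ← card_closedNeighborFinset, hp.degree_eq,
    ← card_sdiff_of_subset highNeighborFinset_subset]
  refine card_le_card fun x hx => ?_
  obtain ⟨hxN, hxH⟩ := mem_sdiff.1 hx
  refine mem_filter.2 ⟨hxN, ?_⟩
  rcases mem_closedNeighborFinset.1 hxN with rfl | hpx
  · exact hpw.symm
  · have hxn : G.degree x = n := by
      by_contra hxn
      exact hxH (mem_highNeighborFinset.2 ⟨hpx, hxn⟩)
    exact (hp.adj_of_degree_eq hpx hxn hpw fun h => hwn (h ▸ hxn)).symm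

namespace IsOreCritical

theorem degreeIn_compl_closedNeighborFinset_le (hG : IsOreCritical G n) (hp : HasLowTwins G n p)
    (hw : w ∈ highNeighborFinset G n p) :
    degreeIn G (closedNeighborFinset G p)ᶜ w ≤ #(highNeighborFinset G n p) := by
  have hinner := hp.le_degreeIn_closedNeighborFinset hw
  have hsplit := degreeIn_union (G := G) (disjoint_compl_right (a := closedNeighborFinset G p)) w
  rw [union_compl, degreeIn_univ] at hsplit
  have hdeg := hG.degree_le w
  omega

theorem exists_isProperOn_erase (hG : IsOreCritical G n) (hp : HasLowTwins G n p)
    (hpq : G.Adj p q) (hq : G.degree q = n) {S : Finset V} (hS : (closedNeighborFinset G p)ᶜ ⊆ S)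
    (hpS : p ∉ S) (hqS : q ∉ S) {c : V → Fin n} (hc : IsProperOn G S c) :
    ∃ c' : V → Fin n, IsProperOn G (univ.erase p) c' ∧ ∀ x ∈ S, c' x = c x := by
  have hqp : q ∈ univ.erase p := mem_erase.2 ⟨hpq.ne', mem_univ q⟩
  have hSR : S ⊆ (univ.erase p).erase q :=
    subset_erase.2 ⟨subset_erase.2 ⟨subset_univ S, hpS⟩, hqS⟩
  -- A neighbour `v ≠ q` of `p` has degree at most `n + 1`, of which `p` and `q` are uncoloured.
  obtain ⟨c₁, hc₁, hext₁⟩ := hc.exists_union_of_degreeIn_lt ((univ.erase p).erase q \ S)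
    disjoint_sdiff fun v hv => by
      obtain ⟨hvR, hvS⟩ := mem_sdiff.1 hv
      have hvp : v ≠ p := ne_of_mem_erase (mem_of_mem_erase hvR)
      have hpv : G.Adj p v := (mem_closedNeighborFinset.1
        (by_contra fun h => hvS (hS (mem_compl.2 h)))).resolve_left hvp
      have hqv := hp.adj_of_degree_eq hpq hq hpv (ne_of_mem_erase hvR)
      have hdegq := degreeIn_erase_add_one hqp hqv.symm
      have hdegp := degreeIn_univ_erase_add_one hpv.symm
      have hdeg := hG.degree_le v
      rw [union_sdiff_of_subset hSR, Fintype.card_fin]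
      omega
  rw [union_sdiff_of_subset hSR] at hc₁
  obtain ⟨c₂, hc₂, hext₂⟩ := hc₁.exists_insert_of_degreeIn_lt (notMem_erase q _) <| by
    have hdegp := degreeIn_univ_erase_add_one hpq.symm
    rw [degreeIn_erase_self, Fintype.card_fin]
    omega
  rw [insert_erase hqp] at hc₂
  exact ⟨c₂, hc₂, fun x hx => (hext₂ x (hSR hx)).trans (hext₁ x hx)⟩

theorem apply_ne_apply (hG : IsOreCritical G n) (hp : G.degree p = n) {c : V → Fin n}
    (hc : IsProperOn G (univ.erase p) c) (h₁ : G.Adj p w₁) (h₂ : G.Adj p w₂) (hne : w₁ ≠ w₂) :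
    c w₁ ≠ c w₂ := by
  intro hc₁₂
  have hinj : ¬ Set.InjOn c {w ∈ univ.erase p | G.Adj p w} := fun h =>
    hne (h (by simp [h₁, h₁.ne']) (by simp [h₂, h₂.ne']) hc₁₂)
  obtain ⟨c', hc', -⟩ := hc.exists_insert_of_not_injOn (notMem_erase p univ)
    (by rw [degreeIn_erase_self, degreeIn_univ, hp, Fintype.card_fin]) hinj
  exact hG.isCritical.not_colorableOn ⟨c', insert_erase (mem_univ p) ▸ hc'⟩

theorem disjoint_freeColors (hG : IsOreCritical G n) (hp : HasLowTwins G n p) {c : V → Fin n}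
    (hc : IsProperOn G (closedNeighborFinset G p)ᶜ c) (h₁ : w₁ ∈ highNeighborFinset G n p)
    (h₂ : w₂ ∈ highNeighborFinset G n p) (hne : w₁ ≠ w₂) :
    Disjoint (freeColors G c (closedNeighborFinset G p)ᶜ w₁)
      (freeColors G c (closedNeighborFinset G p)ᶜ w₂) := by
  rw [disjoint_left]
  intro γ hγ₁ hγ₂
  rw [mem_highNeighborFinset] at h₁ h₂
  obtain ⟨q, hpq, hq⟩ := hp.exists_adj_degree_eq
  have hind : G.IsIndepSet (({w₁, w₂} : Finset V) : Set V) := by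
    have hadj : ¬ G.Adj w₁ w₂ := fun h => (hG.degree_eq_or_degree_eq h).elim h₁.2 h₂.2
    simpa [SimpleGraph.IsIndepSet, Set.pairwise_pair, G.adj_comm w₂] using fun _ => hadj
  have hfree : ∀ x ∈ ({w₁, w₂} : Finset V), ∀ y ∈ (closedNeighborFinset G p)ᶜ, G.Adj x y →
      c y ≠ γ := by
    rintro x hx y hy hxy rfl
    have hmem : c y ∈ {z ∈ (closedNeighborFinset G p)ᶜ | G.Adj x z}.image c :=
      mem_image_of_mem c (mem_filter.2 ⟨hy, hxy⟩)
    rw [mem_insert, mem_singleton] at hx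
    rcases hx with rfl | rfl
    · exact mem_compl.1 hγ₁ hmem
    · exact mem_compl.1 hγ₂ hmem
  have hpS : p ∉ {w₁, w₂} ∪ (closedNeighborFinset G p)ᶜ := by
    simp [mem_closedNeighborFinset, h₁.1.ne, h₂.1.ne]
  have hqS : q ∉ {w₁, w₂} ∪ (closedNeighborFinset G p)ᶜ := by
    have hq₁ : q ≠ w₁ := fun h => h₁.2 (h ▸ hq)
    have hq₂ : q ≠ w₂ := fun h => h₂.2 (h ▸ hq)
    simp [mem_closedNeighborFinset, hq₁, hq₂, hpq]
  obtain ⟨c', hc', hext⟩ := hG.exists_isProperOn_erase hp hpq hq subset_union_right hpS hqS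
    (hc.piecewise_const hind hfree)
  refine hG.apply_ne_apply hp.degree_eq hc' h₁.1 h₂.1 hne ?_
  rw [hext w₁ (by simp), hext w₂ (by simp)]
  simp

theorem card_highNeighborFinset_le_one (hG : IsOreCritical G n) (hn : 5 ≤ n)
    (hp : HasLowTwins G n p) : #(highNeighborFinset G n p) ≤ 1 := by
  by_contra! hcard
  obtain ⟨c, hc⟩ := hG.isCritical.colorableOn_erase p (mem_univ p)
  have hcO : IsProperOn G (closedNeighborFinset G p)ᶜ c := hc.mono fun x hx =>
    mem_erase.2 ⟨fun h => mem_compl.1 hx (mem_closedNeighborFinset.2 (Or.inl h)), mem_univ x⟩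
  have hle := card_mul_le_card_of_pairwiseDisjoint
    (fun w₁ h₁ w₂ h₂ hne => hG.disjoint_freeColors hp hcO h₁ h₂ hne)
    fun w hw => (Nat.sub_le_sub_left (hG.degreeIn_compl_closedNeighborFinset_le hp hw) _).trans
      (card_sub_degreeIn_le_card_freeColors c _ w)
  rw [Fintype.card_fin] at hle
  exact hle.not_gt (lt_mul_sub hn hcard hp.card_highNeighborFinset_add_two_le)

theorem isNClique_closedNeighborFinset (hG : IsOreCritical G n) (hn : 5 ≤ n)
    (hp : HasLowTwins G n p) : G.IsNClique (n + 1) (closedNeighborFinset G p) := by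
  refine ⟨?_, by rw [card_closedNeighborFinset, hp.degree_eq]⟩
  rw [closedNeighborFinset, coe_insert, SimpleGraph.isClique_insert]
  refine ⟨fun x hx y hy hxy => ?_, fun y hy _ => by simpa using hy⟩
  rw [mem_coe, SimpleGraph.mem_neighborFinset] at hx hy
  by_cases hxn : G.degree x = n
  · exact hp.adj_of_degree_eq hx hxn hy hxy.symm
  · by_cases hyn : G.degree y = n
    · exact (hp.adj_of_degree_eq hy hyn hx hxy).symm
    · exact (hxy (card_le_one.1 (hG.card_highNeighborFinset_le_one hn hp)
        x (mem_highNeighborFinset.2 ⟨hx, hxn⟩) y (mem_highNeighborFinset.2 ⟨hy, hyn⟩))).elim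

end IsOreCritical

end Clique

section OreDegree

variable {V : Type*} [Fintype V] {G : SimpleGraph V} [DecidableRel G.Adj] [DecidableEq V] {n : ℕ}

theorem degree_add_degree_le_oreDegree {v w : V} (h : G.Adj v w) :
    G.degree v + G.degree w ≤ G.oreDegree :=
  le_sup (f := G.edgeOreDegree) (b := s(v, w)) (by simpa using h)

theorem IsCritical.isOreCritical_induce {S : Finset V} (hS : IsCritical G S n) (hn : 0 < n)
    (hθ : G.oreDegree ≤ 2 * n + 1) : IsOreCritical (G.induce (S : Set V)) n where
  isCritical := hS.induce hn
  degree_add_degree_le v w hvw := by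
    have hle (x : (S : Set V)) : (G.induce (S : Set V)).degree x ≤ G.degree x :=
      (SimpleGraph.Embedding.induce (G := G) (S : Set V)).toCopy.degree_le x
    exact (add_le_add (hle v) (hle w)).trans
      ((degree_add_degree_le_oreDegree (G := G) hvw).trans hθ)

theorem IsOreCritical.not_cliqueFree (hG : IsOreCritical G n) (hn : 5 ≤ n) :
    ¬ G.CliqueFree (n + 1) := by
  have hsplit : IsOreSplit G n fun b => if b then 2 else n - 2 :=
    ⟨hG, fun b => by cases b <;> simp <;> omega, fun b => by cases b <;> simp; omega⟩
  obtain ⟨p, hp⟩ := hsplit.exists_hasLowTwins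
  exact fun hfree => hfree _ (hG.isNClique_closedNeighborFinset hn hp)

theorem not_cliqueFree_of_oreDegree_le (hn : 5 ≤ n) (hcol : ¬ G.Colorable n)
    (hθ : G.oreDegree ≤ 2 * n + 1) : ¬ G.CliqueFree (n + 1) := by
  obtain ⟨S, -, hS⟩ := exists_isCritical_of_not_colorableOn (mt colorableOn_univ_iff.1 hcol)
  exact fun hfree => (hS.isOreCritical_induce (by omega) hθ).not_cliqueFree hn
    (hfree.comap ⟨(SimpleGraph.Embedding.induce (G := G) (S : Set V)).toCopy⟩)

end OreDegree

end OreBrooks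

theorem corollaryO {V : Type*} [Fintype V] [DecidableEq V] (G : SimpleGraph V)
    [DecidableRel G.Adj] (h6 : 6 ≤ G.chromaticNumber)
    (hθ : G.chromaticNumber = ((G.oreDegree / 2 + 1 : ℕ) : ℕ∞)) :
    (SimpleGraph.completeGraph (Fin G.chromaticNumber.toNat)).IsContained G := by
  have hn : 5 ≤ G.oreDegree / 2 := by
    rw [hθ] at h6
    have : 6 ≤ G.oreDegree / 2 + 1 := by exact_mod_cast h6
    omega
  have hcol : ¬ G.Colorable (G.oreDegree / 2) := fun h => by
    have hle := SimpleGraph.chromaticNumber_le_iff_colorable.2 h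
    rw [hθ, Nat.cast_le] at hle
    omega
  have hclique : ¬ G.CliqueFree (G.oreDegree / 2 + 1) :=
    OreBrooks.not_cliqueFree_of_oreDegree_le hn hcol (by omega)
  rw [hθ, ENat.toNat_natCast]
  exact ⟨(SimpleGraph.topEmbeddingOfNotCliqueFree hclique).toCopy⟩
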